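/- **Model.** A deterministic AMPC algorithm with I/O capacity $S$ on $N$ input bits uses a finite set of machines (of any size) and a sequence of data stores $\mathcal D_0,\mathcal D_1,\dots$, each a multiset of key-value pairs; there is no restriction on what a value may encode. The store $\mathcal D_0$ consists of the pairs $(i,x_i)$, $1\le i\le N$, where $x\in\{0,1\}^N$ is the input. In round $r\ge 1$ every machine adaptively queries keys in $\mathcal D_{r-1}$; the response to a query is the whole multiset of values stored under the key. When it stops querying, the machine writes key-value pairs determined by the round, the machine and the responses it received, and $\mathcal D_r$ consists of all the pairs written in round $r$. The read cost of a machine in a round is the total number of values in all responses plus the number of queries with an empty response; a machine whose read cost exceeds $S$ writes nothing. The algorithm computes a partial Boolean function $g:\Delta\to\{0,1\}$, $\Delta\subseteq\{0,1\}^N$, in $R$ rounds if: on every input $x\in\Delta$ every machine in each of the rounds $1,\dots,R$ has read cost at most $S$ and writes at most $S$ pairs; on every input $x\in\{0,1\}^N$ (also outside $\Delta$), in each of these rounds at most $S$ values are written under any single key; and on every $x\in\Delta$ the store $\mathcal D_R$ consists of the single pair $(\textsc{answer},g(x))$. For even $n$, $\mathrm{1v2\text{-}Cycle}$ is the partial Boolean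 function on $N=\binom n2$ bits (one for each potential edge of an undirected graph on $n$ labelled vertices) whose domain is the set of all graphs that are either a cycle of length $n$ (value $1$) or the disjoint union of two cycles of length $n/2$ (value $0$). **Theorem.** Let $n$ be even and let $S>1$ be real. Any deterministic AMPC algorithm with I/O capacity $S$ that computes $\mathrm{1v2\text{-}Cycle}$ on $n$ vertices in $R$ rounds satisfies $$R\;\ge\;\tfrac13\log_S n-\tfrac13\log_S 32 .$$ Consequently $R=\Omega(\log_S n)$: there are absolute constants $c>0$ and $n_0$ such that $R\ge c\log_S n$ for all even $n\ge n_0$, all $S>1$ and all such algorithms. In particular, if $S=n^{\varepsilon}$ with $\varepsilon\in(0,1)$, then $R=\Omega(1/\varepsilon)$: there are absolute constants $c>0$ and $n_0$ such that $R\ge c/\varepsilon$ for all $\varepsilon\in(0,1)$, all even $n\ge n_0$ and all such algorithms with $S=n^{\varepsilon}$. -/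

import Mathlib

/-- Keys of the distributed data stores: one key for each input position `i : ι`, the key
`answer`, and an arbitrary supply `κ` of further keys. -/
inductive AMPCKey (ι κ : Type*) where
  | input (i : ι)
  | answer
  | aux (k : κ)

/-- Values in the distributed data stores: the two bits and an arbitrary supply `ν` of further
values (the model puts no limit on what a single value may encode). -/
inductive AMPCValue (ν : Type*) where
  | bit (b : Bool)
  | aux (w : ν)

/-- A distributed data store: a multiset of key-value pairs. -/
abbrev DDS (K V : Type*) := Multiset (K × V)

open scoped Classical in
/-- The response to a query for the key `k`: the whole multiset of values stored under `k`. -/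
noncomputable def DDS.lookup {K V : Type*} (D : DDS K V) (k : K) : Multiset V :=
  (D.filter (fun p => p.1 = k)).map Prod.snd

/-- What a machine does in one round: it either stops and writes the key-value pairs `out`, or
queries a key and goes on in a way that depends on the response (an adaptive decision tree). -/
inductive MachineProgram (K V : Type*) where
  | write (out : Multiset (K × V))
  | query (k : K) (next : Multiset V → MachineProgram K V)

/-- Total number of values in all responses plus the number of queries with an empty response,
when the program is run on the store `D`: a query costs the size of its response, or `1` if the
response is empty. -/
noncomputable def MachineProgram.readCost {K V : Type*} (D : DDS K V) :
    MachineProgram K V → ℕ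
  | .write _ => 0
  | .query k next =>
      max 1 (D.lookup k).card + (next (D.lookup k)).readCost D

/-- The key-value pairs that the program writes when all its queries are answered from `D`. -/
noncomputable def MachineProgram.written {K V : Type*} (D : DDS K V) :
    MachineProgram K V → Multiset (K × V)
  | .write out => out
  | .query k next => (next (D.lookup k)).written D

open scoped Classical in
/-- The output of a machine with I/O capacity `S`: a machine whose responses exceed the capacity
stops and writes nothing. -/
noncomputable def MachineProgram.output {K V : Type*} (S : ℝ) (D : DDS K V)
    (P : MachineProgram K V) : Multiset (K × V) :=
  if (P.readCost D : ℝ) ≤ S then P.written D else 0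

/-- A deterministic AMPC algorithm on input bits indexed by `ι`, with set of machines `M`:
`program r v` is what machine `v` does in round `r + 1`. -/
structure AMPCAlgorithm (ι κ ν M : Type*) where
  program : ℕ → M → MachineProgram (AMPCKey ι κ) (AMPCValue ν)

/-- The initial store: the pairs `(i, x_i)`. -/
def initialDDS {ι : Type*} (κ ν : Type*) [Fintype ι] (x : ι → Bool) :
    DDS (AMPCKey ι κ) (AMPCValue ν) :=
  (Finset.univ : Finset ι).val.map (fun i => (AMPCKey.input i, AMPCValue.bit (x i)))

/-- The store after round `r` of the computation on `x`: everything written in round `r` by all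
the machines, each of which reads only the store of the previous round. -/
noncomputable def AMPCAlgorithm.dds {ι κ ν M : Type*} [Fintype ι] [Fintype M]
    (A : AMPCAlgorithm ι κ ν M) (S : ℝ) (x : ι → Bool) :
    ℕ → DDS (AMPCKey ι κ) (AMPCValue ν)
  | 0 => initialDDS κ ν x
  | r + 1 => ∑ v : M, (A.program r v).output S (A.dds S x r)

/-- `A`, with I/O capacity `S`, computes the partial Boolean function `g` with domain `Δ` in
`R` rounds. -/
structure AMPCAlgorithm.Computes {ι κ ν M : Type*} [Fintype ι] [Fintype M]
    (A : AMPCAlgorithm ι κ ν M) (S : ℝ) (R : ℕ) {Δ : Set (ι → Bool)} (g : Δ → Bool) :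
    Prop where
  /-- On valid inputs every machine respects the capacity for reading in every round. -/
  read_le : ∀ x ∈ Δ, ∀ r < R, ∀ v : M, ((A.program r v).readCost (A.dds S x r) : ℝ) ≤ S
  /-- On valid inputs every machine respects the capacity for writing in every round. -/
  write_le : ∀ x ∈ Δ, ∀ r < R, ∀ v : M,
    (((A.program r v).output S (A.dds S x r)).card : ℝ) ≤ S
  /-- On all inputs, valid or not, in each round at most `S` values are written under any key. -/
  key_le : ∀ x : ι → Bool, ∀ r < R, ∀ k,
    (((A.dds S x (r + 1)).lookup k).card : ℝ) ≤ S
  /-- On a valid input the final store consists of the single pair `(answer, g x)`. -/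
  correct : ∀ x : Δ, A.dds S (x : ι → Bool) R = {(AMPCKey.answer, AMPCValue.bit (g x))}

/-- The `n.choose 2` potential edges of a graph on `n` vertices; the input has one bit for each. -/
abbrev PotentialEdge (n : ℕ) := {e : Sym2 (Fin n) // ¬ e.IsDiag}

/-- The undirected graph whose edges are those with input bit `1`. -/
def inputGraph {n : ℕ} (x : PotentialEdge n → Bool) : SimpleGraph (Fin n) :=
  SimpleGraph.fromEdgeSet {e | ∃ h : ¬ e.IsDiag, x ⟨e, h⟩ = true}

/-- The graph is a cycle of length `n`. -/
def IsOneCycle {n : ℕ} (x : PotentialEdge n → Bool) : Prop :=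
  3 ≤ n ∧ Nonempty (inputGraph x ≃g SimpleGraph.cycleGraph n)

/-- The graph is the disjoint union of two cycles, each of length `n / 2` (used for even `n`). -/
def IsTwoCycle {n : ℕ} (x : PotentialEdge n → Bool) : Prop :=
  3 ≤ n / 2 ∧ Nonempty
    (inputGraph x ≃g (SimpleGraph.cycleGraph (n / 2) ⊕g SimpleGraph.cycleGraph (n / 2)))

/-- The domain of the 1-versus-2-cycle problem. -/
def oneVsTwoCycleDomain (n : ℕ) : Set (PotentialEdge n → Bool) :=
  {x | IsOneCycle x ∨ IsTwoCycle x}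

open scoped Classical in
/-- The 1-versus-2-cycle problem: value `1` on a cycle of length `n`, and `0` on two disjoint
cycles of length `n / 2` (the two cases exclude each other, the second being disconnected). -/
noncomputable def oneVsTwoCycle (n : ℕ) : oneVsTwoCycleDomain n → Bool :=
  fun x => decide (IsOneCycle x.1)

/-! The polynomial method, with vector-valued functions because stored values are arbitrary. A
multiset is encoded as a basis vector of the group algebra of multisets, so the content of a key has
a degree as a function on the cube. One round multiplies this degree by at most `⌊S⌋₊ ^ 2`: one
factor for a machine's adaptive reads (`MachineProgram.written_mem_lowDegree`), one for merging the
at most `S` nonempty contributions to a key (`formal_sum_mem_lowDegree`). The inputs are restricted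
to a subcube of valid graphs: two strands of length `m = n / 2` with an optional crossing at each of
`m` positions. Every edge bit depends on one crossing, and the parity of the crossings decides
between one cycle and two. Parity has degree `m`, hence `m ≤ S ^ (2 * R)`, which is stronger than
the stated bound. -/

/-- The `E`-valued functions on the Boolean cube of degree at most `d`: the span of the functions
that depend on at most `d` coordinates. -/
def lowDegree (ι : Type*) (E : Type*) [AddCommGroup E] [Module ℝ E] (d : ℕ) :
    Submodule ℝ ((ι → Bool) → E) :=
  Submodule.span ℝ {F | ∃ T : Finset ι, T.card ≤ d ∧ DependsOn F (T : Set ι)}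

/-! ### Calculus of degree, and the degree of parity. -/

namespace lowDegree

variable {ι E E' G : Type*} [AddCommGroup E] [Module ℝ E] [AddCommGroup E'] [Module ℝ E']
  [AddCommGroup G] [Module ℝ G]

theorem of_dependsOn {F : (ι → Bool) → E} {d : ℕ} (T : Finset ι) (hT : T.card ≤ d)
    (h : DependsOn F (T : Set ι)) : F ∈ lowDegree ι E d :=
  Submodule.subset_span ⟨T, hT, h⟩

theorem const (c : E) (d : ℕ) : (fun _ => c) ∈ lowDegree ι E d :=
  of_dependsOn ∅ (by simp) (fun _ _ _ => rfl)

theorem mono {a b : ℕ} (h : a ≤ b) : lowDegree ι E a ≤ lowDegree ι E b :=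
  Submodule.span_mono fun _ ⟨T, hT, hF⟩ => ⟨T, hT.trans h, hF⟩

theorem map (L : E →ₗ[ℝ] G) {F : (ι → Bool) → E} {d : ℕ} (hF : F ∈ lowDegree ι E d) :
    (fun y => L (F y)) ∈ lowDegree ι G d := by
  induction hF using Submodule.span_induction with
  | mem F h =>
    obtain ⟨T, hT, hF⟩ := h
    exact of_dependsOn T hT fun x y hxy => by simp only [hF hxy]
  | zero => simpa using const (ι := ι) (0 : G) d
  | add F F' _ _ h h' =>
    simp only [Pi.add_apply, map_add]
    exact add_mem h h'
  | smul c F _ h =>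
    simp only [Pi.smul_apply, map_smul]
    exact Submodule.smul_mem _ c h

theorem bilin (B : E →ₗ[ℝ] E' →ₗ[ℝ] G) {F : (ι → Bool) → E} {F' : (ι → Bool) → E'} {a b : ℕ}
    (hF : F ∈ lowDegree ι E a) (hF' : F' ∈ lowDegree ι E' b) :
    (fun y => B (F y) (F' y)) ∈ lowDegree ι G (a + b) := by
  classical
  induction hF using Submodule.span_induction with
  | mem F h =>
    obtain ⟨T, hT, hF⟩ := h
    induction hF' using Submodule.span_induction with
    | mem F' h =>
      obtain ⟨T', hT', hF'⟩ := h
      refine of_dependsOn (T ∪ T') ((Finset.card_union_le _ _).trans (add_le_add hT hT'))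
        fun x y hxy => ?_
      have h1 : F x = F y := hF fun i hi => hxy i (by simp_all)
      have h2 : F' x = F' y := hF' fun i hi => hxy i (by simp_all)
      simp only [h1, h2]
    | zero => simpa using const (ι := ι) (0 : G) (a + b)
    | add F F' _ _ h h' =>
      simp only [Pi.add_apply, map_add]
      exact add_mem h h'
    | smul c F _ h =>
      simp only [Pi.smul_apply, map_smul]
      exact Submodule.smul_mem _ c h
  | zero => simpa using const (ι := ι) (0 : G) (a + b)
  | add F F' _ _ h h' =>
    simp only [Pi.add_apply, map_add, LinearMap.add_apply]
    exact add_mem h h'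
  | smul c F _ h =>
    simp only [Pi.smul_apply, map_smul, LinearMap.smul_apply]
    exact Submodule.smul_mem _ c h

theorem prod {A M : Type*} [CommRing A] [Algebra ℝ A] (T : Finset M) {F : M → (ι → Bool) → A}
    {d : ℕ} (h : ∀ v ∈ T, F v ∈ lowDegree ι A d) :
    (fun y => ∏ v ∈ T, F v y) ∈ lowDegree ι A (T.card * d) := by
  classical
  induction T using Finset.induction_on with
  | empty => simpa using const (ι := ι) (1 : A) 0
  | insert v T hv ih =>
    have := bilin (LinearMap.mul ℝ A) (h v (by simp)) (ih fun w hw => h w (by simp [hw]))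
    rw [Finset.card_insert_of_notMem hv, add_one_mul, add_comm]
    simpa [Finset.prod_insert hv] using this

/-- The parity character is orthogonal to every function of degree less than the number of
coordinates. -/
theorem sum_sign_mul_eq_zero [Fintype ι] [DecidableEq ι] {F : (ι → Bool) → ℝ} {d : ℕ}
    (hF : F ∈ lowDegree ι ℝ d) (hd : d < Fintype.card ι) :
    ∑ y : ι → Bool, (∏ i, if y i then (-1 : ℝ) else 1) * F y = 0 := by
  induction hF using Submodule.span_induction with
  | mem F h =>
    obtain ⟨T, hT, hF⟩ := h
    obtain ⟨j, hj⟩ : ∃ j, j ∉ T := by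
      by_contra! hall
      have : T = Finset.univ := by ext; simp [hall]
      rw [this, Finset.card_univ] at hT
      omega
    -- Flipping a coordinate outside `T` reverses the character and fixes `F`.
    refine Finset.sum_involution (fun y _ => Function.update y j (!y j)) ?_ ?_ (by simp) ?_
    · intro y _
      have h1 : F (Function.update y j (!y j)) = F y := hF fun i hi => by
        rw [Function.update_of_ne]
        rintro rfl
        exact hj hi
      have h2 : ∏ i ∈ Finset.univ.erase j, (if Function.update y j (!y j) i then (-1 : ℝ) else 1)
          = ∏ i ∈ Finset.univ.erase j, (if y i then (-1 : ℝ) else 1) :=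
        Finset.prod_congr rfl fun i hi => by
          rw [Function.update_of_ne (Finset.ne_of_mem_erase hi)]
      rw [h1, ← Finset.mul_prod_erase _ _ (Finset.mem_univ j),
        ← Finset.mul_prod_erase _ _ (Finset.mem_univ j), h2]
      cases hy : y j <;> simp
    · intro y _ _ h
      have := congrFun h j
      simp at this
    · intro y _
      ext i
      by_cases h : i = j
      · subst h; simp
      · simp [h]
  | zero => simp
  | add F F' _ _ h h' => simp [mul_add, Finset.sum_add_distrib, h, h']
  | smul c F _ h => simp [mul_left_comm _ c, ← Finset.mul_sum, h]

/-- The parity function on `ι` has degree at least the number of coordinates. -/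
theorem card_le_of_parity [Fintype ι] [DecidableEq ι] {F : (ι → Bool) → ℝ} {d : ℕ} (hF : F ∈ lowDegree ι ℝ d)
    (hpar : ∀ y, F y = if (∏ i, if y i then (-1 : ℝ) else 1) = -1 then 1 else 0) :
    Fintype.card ι ≤ d := by
  by_contra! hd
  have h0 := sum_sign_mul_eq_zero hF hd
  -- On the support of `F` the character is `-1`, so orthogonality forces the nonnegative `F` to
  -- vanish; a point with a single `true` bit contradicts this.
  have hterm : ∀ y : ι → Bool, (∏ i, if y i then (-1 : ℝ) else 1) * F y = - F y := fun y => by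
    rw [hpar y]
    split_ifs with h <;> simp [h]
  simp only [hterm, Finset.sum_neg_distrib, neg_eq_zero] at h0
  have hnn : ∀ y ∈ Finset.univ, 0 ≤ F y := fun y _ => by
    rw [hpar y]; split_ifs <;> norm_num
  rw [Finset.sum_eq_zero_iff_of_nonneg hnn] at h0
  obtain ⟨j⟩ : Nonempty ι := Fintype.card_pos_iff.1 (by omega)
  have h1 := h0 (Function.update (fun _ => false) j true) (Finset.mem_univ _)
  rw [hpar, if_pos] at h1
  · exact one_ne_zero h1
  · rw [← Finset.mul_prod_erase _ _ (Finset.mem_univ j), Finset.prod_eq_one]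
    · simp
    · intro i hi
      simp [Finset.ne_of_mem_erase hi]

end lowDegree

/-! ### Multisets as basis vectors of a group algebra. -/

section Lookup

variable {K V : Type*}

theorem DDS.lookup_zero (k : K) : DDS.lookup (0 : DDS K V) k = 0 := by
  simp [DDS.lookup]

theorem DDS.lookup_add (D D' : DDS K V) (k : K) :
    DDS.lookup (D + D') k = DDS.lookup D k + DDS.lookup D' k := by
  simp [DDS.lookup]

theorem DDS.lookup_sum {M : Type*} (T : Finset M) (D : M → DDS K V) (k : K) :
    DDS.lookup (∑ v ∈ T, D v) k = ∑ v ∈ T, DDS.lookup (D v) k :=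
  map_sum (⟨⟨fun D : DDS K V => DDS.lookup D k, DDS.lookup_zero k⟩,
    fun D D' => DDS.lookup_add D D' k⟩ : DDS K V →+ Multiset V) D T

/-- The basis vector of the group algebra that represents a multiset. -/
noncomputable def formal {X : Type*} (m : Multiset X) : AddMonoidAlgebra ℝ (Multiset X) :=
  AddMonoidAlgebra.single m 1

/-- The linear map that sends `formal m` to `φ m`. -/
noncomputable def formalLift {X E : Type*} [AddCommGroup E] [Module ℝ E] (φ : Multiset X → E) :
    AddMonoidAlgebra ℝ (Multiset X) →ₗ[ℝ] E :=
  Finsupp.linearCombination ℝ φ ∘ₗ (AddMonoidAlgebra.coeffLinearEquiv ℝ).toLinearMap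

@[simp]
theorem formalLift_formal {X E : Type*} [AddCommGroup E] [Module ℝ E] (φ : Multiset X → E)
    (m : Multiset X) : formalLift φ (formal m) = φ m := by
  simp [formalLift, formal]

theorem formal_zero {X : Type*} : formal (0 : Multiset X) = 1 := rfl

/-- This is the reason for using the group algebra: merging contributions becomes multiplication, to
which degree bounds apply. -/
theorem formal_sum {X M : Type*} (T : Finset M) (m : M → Multiset X) :
    formal (∑ v ∈ T, m v) = ∏ v ∈ T, formal (m v) := by
  classical
  induction T using Finset.induction_on with
  | empty => simp [formal_zero]
  | insert v T hv ih =>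
    rw [Finset.sum_insert hv, Finset.prod_insert hv, ← ih]
    simp [formal, AddMonoidAlgebra.single_mul_single]

end Lookup

/-! ### Growth of the degree in one round. -/

section Degree

variable {ι K V : Type*} {D : (ι → Bool) → DDS K V} {d : ℕ}

open scoped Classical in
/-- A program whose read cost is at most `s`, run on a store of degree `d`, writes with degree
at most `s * d`. -/
theorem MachineProgram.written_mem_lowDegree [Finite ι]
    (hD : ∀ k, (fun y => formal ((D y).lookup k)) ∈ lowDegree ι _ d) (P : MachineProgram K V)
    (s : ℕ) :
    (fun y => if P.readCost (D y) ≤ s then formal (P.written (D y)) else 0) ∈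
      lowDegree ι _ (s * d) := by
  have := Fintype.ofFinite ι
  induction P generalizing s with
  | write out => simpa [readCost, written] using lowDegree.const (formal out) (s * d)
  | query k next ih =>
    -- Split by the first response `m`, which takes finitely many values on the finite cube. Its
    -- indicator is linear in `formal` of the response, so it has degree `d`.
    have key : (fun y => if (query k next).readCost (D y) ≤ s then
          formal ((query k next).written (D y)) else 0) =
        ∑ m ∈ Finset.univ.image (fun y => (D y).lookup k), fun y =>
          (LinearMap.lsmul ℝ (AddMonoidAlgebra ℝ (Multiset (K × V)))
            (formalLift (fun m' => if m' = m then (1 : ℝ) else 0) (formal ((D y).lookup k))))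
          (if max 1 m.card ≤ s then
            (if (next m).readCost (D y) ≤ s - max 1 m.card then
              formal ((next m).written (D y)) else 0) else 0) := by
      ext1 y
      rw [Finset.sum_apply, Finset.sum_eq_single ((D y).lookup k)]
      · simp only [readCost, written, formalLift_formal, if_true, LinearMap.lsmul_apply, one_smul]
        by_cases h : max 1 ((D y).lookup k).card ≤ s
        · rw [if_pos h]
          refine if_congr ?_ rfl rfl
          omega
        · rw [if_neg h]
          exact if_neg (by omega)
      · intro m _ hm
        simp [Ne.symm hm]
      · intro h
        exact absurd (Finset.mem_image_of_mem _ (Finset.mem_univ y)) h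
    rw [key]
    refine Submodule.sum_mem _ fun m _ => ?_
    by_cases h : max 1 m.card ≤ s
    · simp only [h, if_true]
      refine lowDegree.mono ?_ (lowDegree.bilin (LinearMap.lsmul ℝ _)
        (lowDegree.map (formalLift fun m' => if m' = m then (1 : ℝ) else 0) (hD k))
        (ih m (s - max 1 m.card)))
      -- Even an empty response costs `1`, so the budget left pays for the `d` spent on this query.
      calc d + (s - max 1 m.card) * d = (1 + (s - max 1 m.card)) * d := by ring
        _ ≤ s * d := Nat.mul_le_mul_right d (by omega)
    · simpa [h] using lowDegree.const (ι := ι) (0 : AddMonoidAlgebra ℝ (Multiset (K × V))) (s * d)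

/-- The values that a machine of capacity `S` stores under a key have degree at most
`⌊S⌋₊ * d`. -/
theorem MachineProgram.lookup_output_mem_lowDegree [Finite ι]
    (hD : ∀ k, (fun y => formal ((D y).lookup k)) ∈ lowDegree ι _ d) (P : MachineProgram K V)
    {S : ℝ} (hS : 0 ≤ S) (k : K) :
    (fun y => formal (DDS.lookup (P.output S (D y)) k) - 1) ∈ lowDegree ι _ (⌊S⌋₊ * d) := by
  classical
  -- An exceeded budget gives the vector `0`, which is not `formal 0 = 1`; after subtracting `1` it
  -- agrees with writing nothing.
  have h := lowDegree.map (formalLift fun w : Multiset (K × V) => formal (DDS.lookup w k) - 1)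
    (P.written_mem_lowDegree hD ⌊S⌋₊)
  convert h using 2 with y
  rw [MachineProgram.output]
  simp only [Nat.le_floor_iff hS]
  split_ifs
  · simp
  · simp [DDS.lookup_zero, formal_zero]

/-- A multiset that is assembled from pieces of degree `e`, of which at most `s` are nonempty, has
degree at most `s * e`. -/
theorem formal_sum_mem_lowDegree {M : Type*} [Fintype M] {W : M → (ι → Bool) → Multiset V}
    {e s : ℕ} (hW : ∀ v, (fun y => formal (W v y) - 1) ∈ lowDegree ι _ e)
    (hs : ∀ y, (∑ v, W v y).card ≤ s) :
    (fun y => formal (∑ v, W v y)) ∈ lowDegree ι _ (s * e) := by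
  classical
  -- Expand `∏ (1 + (formal (W v y) - 1))`. A factor vanishes when `W v y` is empty, so only sets of
  -- at most `s` machines survive, however many machines there are.
  have key : (fun y => formal (∑ v, W v y)) =
      ∑ T : Finset M, fun y => ∏ v ∈ T, (formal (W v y) - 1) := by
    ext1 y
    rw [formal_sum, Finset.sum_apply, ← Finset.powerset_univ, ← Finset.prod_one_add]
    simp
  rw [key]
  refine Submodule.sum_mem _ fun T _ => ?_
  by_cases hT : T.card ≤ s
  · exact lowDegree.mono (Nat.mul_le_mul_right e hT) (lowDegree.prod T fun v _ => hW v)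
  · convert lowDegree.const (ι := ι) (0 : AddMonoidAlgebra ℝ (Multiset V)) (s * e) using 2 with y
    obtain ⟨v, hv, h0⟩ : ∃ v ∈ T, W v y = 0 := by
      by_contra! hne
      refine hT (le_trans ?_ (hs y))
      calc T.card = ∑ v ∈ T, 1 := by simp
        _ ≤ ∑ v ∈ T, (W v y).card :=
          Finset.sum_le_sum fun v hv => Multiset.card_pos.2 (hne v hv)
        _ ≤ ∑ v, (W v y).card := Finset.sum_le_univ_sum_of_nonneg fun _ => Nat.zero_le _
        _ = (∑ v, W v y).card := by simp
    exact Finset.prod_eq_zero hv (by simp [h0, formal_zero])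

end Degree

theorem lookup_initialDDS {ι κ ν : Type*} [Fintype ι] (x : ι → Bool) (k : AMPCKey ι κ) :
    ∀ x' : ι → Bool, (∀ i, k = AMPCKey.input i → x i = x' i) →
      DDS.lookup (initialDDS κ ν x) k = DDS.lookup (initialDDS κ ν x') k := by
  classical
  intro x' h
  simp only [DDS.lookup, initialDDS, Multiset.filter_map, Multiset.map_map, Function.comp_def]
  refine Multiset.map_congr rfl fun i hi => ?_
  rw [h i (Multiset.mem_filter.1 hi).2.symm]

/-- If the input bits each depend on at most one coordinate of `y`, then the store after round `r`
has degree at most `(⌊S⌋₊ * ⌊S⌋₊) ^ r` in `y`. -/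
theorem AMPCAlgorithm.dds_mem_lowDegree {ι J κ ν M : Type*} [Fintype ι] [Finite J] [Fintype M]
    (A : AMPCAlgorithm ι κ ν M) {S : ℝ} (hS : 0 ≤ S) {R : ℕ} (x : (J → Bool) → ι → Bool)
    (hx : ∀ i, ∃ T : Finset J, T.card ≤ 1 ∧ DependsOn (fun y => x y i) (T : Set J))
    (hkey : ∀ y, ∀ r < R, ∀ k, (((A.dds S (x y) (r + 1)).lookup k).card : ℝ) ≤ S)
    (r : ℕ) (hr : r ≤ R) (k : AMPCKey ι κ) :
    (fun y => formal ((A.dds S (x y) r).lookup k)) ∈ lowDegree J _ ((⌊S⌋₊ * ⌊S⌋₊) ^ r) := by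
  induction r generalizing k with
  | zero =>
    have hk : ∃ T : Finset J, T.card ≤ 1 ∧
        ∀ i, k = AMPCKey.input i → DependsOn (fun y => x y i) (T : Set J) := by
      cases k with
      | input i =>
        obtain ⟨T, hT, h⟩ := hx i
        exact ⟨T, hT, fun i' hi => by cases hi; exact h⟩
      | answer => exact ⟨∅, by simp, by simp⟩
      | aux k => exact ⟨∅, by simp, by simp⟩
    obtain ⟨T, hT, h⟩ := hk
    refine lowDegree.of_dependsOn T (by simpa using hT) fun y y' hy => ?_
    simp only [AMPCAlgorithm.dds]
    rw [lookup_initialDDS (x y) k (x y') fun i hi => h i hi hy]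
  | succ r ih =>
    have hsum : ∀ y, (A.dds S (x y) (r + 1)).lookup k =
        ∑ v, DDS.lookup ((A.program r v).output S (A.dds S (x y) r)) k := fun y => by
      rw [AMPCAlgorithm.dds, DDS.lookup_sum]
    simp only [hsum]
    rw [pow_succ', mul_assoc]
    refine formal_sum_mem_lowDegree (fun v =>
      (A.program r v).lookup_output_mem_lowDegree (fun k => ih (by omega) k) hS k) fun y => ?_
    rw [← hsum]
    exact Nat.le_floor (hkey y r hr k)

/-! ### Embedding parity into the cycle problem. -/

section TwoStrands

/-- `b` follows `a` on the cycle `0, 1, …, n - 1`. -/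
def CyclicStep (n a b : ℕ) : Prop := a + 1 = b ∨ (a + 1 = n ∧ b = 0)

theorem cycleGraph_adj_iff_cyclicStep {n : ℕ} (hn : 2 ≤ n) (u v : Fin n) :
    (SimpleGraph.cycleGraph n).Adj u v ↔ CyclicStep n u v ∨ CyclicStep n v u := by
  have key : ∀ u v : Fin n, (u - v).val = 1 ↔ CyclicStep n v u := fun u v => by
    unfold CyclicStep
    rcases le_or_gt v u with h | h
    · rw [Fin.sub_val_of_le h]
      have := Fin.le_def.1 h
      omega
    · rw [Fin.coe_sub_iff_lt.2 h]
      have := Fin.lt_def.1 h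
      omega
  rw [SimpleGraph.cycleGraph_adj', key, key, or_comm]

variable {m n : ℕ} (y : Fin m → Bool)

/-- The successor relation on two strands of length `m`, closed up cyclically, where the strands
cross behind position `i` if `y i` is true. -/
def StrandStep (p q : Fin m × Bool) : Prop :=
  CyclicStep m p.1 q.1 ∧ q.2 = xor p.2 (y p.1)

open scoped Classical in
/-- The edge indicators of the two-strand graph, on vertices labelled by `τ`. -/
noncomputable def strandInput (τ : Fin n ≃ Fin m × Bool) : PotentialEdge n → Bool :=
  fun e => decide (∃ u v, StrandStep y (τ u) (τ v) ∧ e.1 = s(u, v))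

theorem strandInput_apply (τ : Fin n ≃ Fin m × Bool) (u v : Fin n) (h : ¬ s(u, v).IsDiag) :
    strandInput y τ ⟨s(u, v), h⟩ = true ↔
      StrandStep y (τ u) (τ v) ∨ StrandStep y (τ v) (τ u) := by
  simp only [strandInput, decide_eq_true_eq]
  constructor
  · rintro ⟨a, b, hab, he⟩
    rcases Sym2.eq_iff.1 he with ⟨rfl, rfl⟩ | ⟨rfl, rfl⟩
    · exact Or.inl hab
    · exact Or.inr hab
  · rintro (h | h)
    · exact ⟨u, v, h, rfl⟩
    · exact ⟨v, u, h, Sym2.eq_swap⟩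

theorem inputGraph_strandInput_adj (hm : 2 ≤ m) (τ : Fin n ≃ Fin m × Bool) (u v : Fin n) :
    (inputGraph (strandInput y τ)).Adj u v ↔
      StrandStep y (τ u) (τ v) ∨ StrandStep y (τ v) (τ u) := by
  rw [inputGraph, SimpleGraph.fromEdgeSet_adj]
  constructor
  · rintro ⟨⟨h, hx⟩, -⟩
    exact (strandInput_apply y τ u v h).1 hx
  · intro h
    have hne : u ≠ v := by
      rintro rfl
      have : CyclicStep m (τ u).1 (τ u).1 := by
        rcases h with h | h <;> exact h.1
      unfold CyclicStep at this
      omega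
    exact ⟨⟨by simpa using hne, (strandInput_apply y τ u v _).2 h⟩, hne⟩

/-- Each edge indicator depends on a single crossing. -/
theorem strandInput_dependsOn (hm : 3 ≤ m) (τ : Fin n ≃ Fin m × Bool) (e : PotentialEdge n) :
    ∃ T : Finset (Fin m), T.card ≤ 1 ∧
      DependsOn (fun y : Fin m → Bool => strandInput y τ e) (T : Set (Fin m)) := by
  obtain ⟨e, he⟩ := e
  induction e using Sym2.ind with
  | _ u v =>
    -- For `m = 2` an edge could arise from steps in both directions and so depend on two crossings.
    have hboth : ¬ (CyclicStep m (τ u).1 (τ v).1 ∧ CyclicStep m (τ v).1 (τ u).1) := by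
      unfold CyclicStep
      omega
    by_cases h1 : CyclicStep m (τ u).1 (τ v).1
    · refine ⟨{(τ u).1}, by simp, fun y y' hy => ?_⟩
      have hy' : y (τ u).1 = y' (τ u).1 := hy _ (by simp)
      have h2 : ¬ CyclicStep m (τ v).1 (τ u).1 := fun h => hboth ⟨h1, h⟩
      rw [Bool.eq_iff_iff, strandInput_apply, strandInput_apply]
      simp [StrandStep, h2, hy']
    · refine ⟨{(τ v).1}, by simp, fun y y' hy => ?_⟩
      have hy' : y (τ v).1 = y' (τ v).1 := hy _ (by simp)
      rw [Bool.eq_iff_iff, strandInput_apply, strandInput_apply]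
      simp [StrandStep, h1, hy']

/-- The parity of the number of crossings before position `j`. -/
def crossParity : ℕ → Bool
  | 0 => false
  | j + 1 => xor (crossParity j) (if h : j < m then y ⟨j, h⟩ else false)

theorem prod_sign_eq_crossParity :
    (∏ i, if y i then (-1 : ℝ) else 1) = if crossParity y m then -1 else 1 := by
  have h : ∀ j, ∏ i ∈ Finset.range j,
      (if (if h : i < m then y ⟨i, h⟩ else false) then (-1 : ℝ) else 1) =
        if crossParity y j then -1 else 1 := fun j => by
    induction j with
    | zero => simp [crossParity]
    | succ j ih =>
      rw [Finset.prod_range_succ, ih, crossParity]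
      generalize (if h : j < m then y ⟨j, h⟩ else false) = b
      cases crossParity y j <;> cases b <;> simp
  rw [← h m, Finset.prod_range]
  simp

/-- The change of labels that moves all crossings to the last position. -/
def straighten : Fin m × Bool ≃ Fin m × Bool where
  toFun p := (p.1, xor p.2 (crossParity y p.1))
  invFun p := (p.1, xor p.2 (crossParity y p.1))
  left_inv p := by simp
  right_inv p := by simp

/-- Relabelling by the parity of earlier crossings absorbs each of them; only the total parity
remains, at the closing step. -/
theorem strandStep_iff (p q : Fin m × Bool) :
    StrandStep y p q ↔
      (p.1.val + 1 = q.1.val ∧ (straighten y q).2 = (straighten y p).2) ∨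
      (p.1.val + 1 = m ∧ q.1.val = 0 ∧
        (straighten y q).2 = xor (straighten y p).2 (crossParity y m)) := by
  obtain ⟨i, a⟩ := p
  obtain ⟨j, b⟩ := q
  have hstep : crossParity y (i.val + 1) = xor (crossParity y i) (y i) := by
    simp [crossParity]
  simp only [StrandStep, CyclicStep, straighten, Equiv.coe_fn_mk]
  by_cases h1 : i.val + 1 = j.val
  · have h2 : ¬ (i.val + 1 = m ∧ j.val = 0) := by omega
    have h3 : ¬ j.val = 0 := by omega
    simp only [h3, false_and, and_false, or_false]
    rw [← h1, hstep]
    cases a <;> cases b <;> cases y i <;> cases crossParity y i <;> simp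
  · by_cases h2 : i.val + 1 = m ∧ j.val = 0
    · obtain ⟨h2, h3⟩ := h2
      rw [h2] at hstep
      have h0 : crossParity y 0 = false := rfl
      have h4 : ¬ m = 0 := by omega
      simp only [h2, h3, h4, hstep, h0, false_and, true_and, false_or, and_self, or_true]
      cases a <;> cases b <;> cases y i <;> cases crossParity y i <;> simp
    · simp only [h1, false_and, false_or]
      tauto

/-- With an odd number of crossings the two strands form one cycle. -/
theorem isOneCycle_strandInput (hm : 3 ≤ m) (hn : n = 2 * m) (τ : Fin n ≃ Fin m × Bool)
    (hodd : crossParity y m = true) : IsOneCycle (strandInput y τ) := by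
  subst hn
  refine ⟨by omega, ?_⟩
  -- Lay the strands end to end: the crossing left at the closing step leads from the end of each
  -- strand to the start of the other.
  let φ : Fin m × Bool → Fin (2 * m) := fun p =>
    ⟨p.1.val + if p.2 then m else 0, by have := p.1.isLt; split_ifs <;> omega⟩
  have hφ : Function.Bijective φ := by
    rw [Fintype.bijective_iff_injective_and_card]
    refine ⟨?_, by simp [mul_comm]⟩
    rintro ⟨i, a⟩ ⟨j, b⟩ h
    have h := Fin.ext_iff.1 h
    have hi := i.isLt
    have hj := j.isLt
    cases a <;> cases b <;> simp [φ, Fin.ext_iff] at h ⊢ <;> omega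
  have hstep : ∀ p q, StrandStep y p q ↔
      CyclicStep (2 * m) (φ (straighten y p)) (φ (straighten y q)) := by
    intro p q
    rw [strandStep_iff, hodd]
    have hp : p.1 = (straighten y p).1 := rfl
    have hq : q.1 = (straighten y q).1 := rfl
    rw [hp, hq]
    obtain ⟨i, a⟩ := straighten y p
    obtain ⟨j, b⟩ := straighten y q
    have hi := i.isLt
    have hj := j.isLt
    cases a <;> cases b <;> simp [φ, CyclicStep] <;> omega
  refine ⟨⟨(τ.trans (straighten y)).trans (Equiv.ofBijective φ hφ), ?_⟩⟩
  intro u v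
  rw [cycleGraph_adj_iff_cyclicStep (by omega), inputGraph_strandInput_adj y (by omega),
    hstep, hstep]
  rfl

/-- With an even number of crossings the two strands form two cycles. -/
theorem isTwoCycle_strandInput (hm : 3 ≤ m) (hn : n = 2 * m) (τ : Fin n ≃ Fin m × Bool)
    (heven : crossParity y m = false) : IsTwoCycle (strandInput y τ) := by
  have hn2 : n / 2 = m := by omega
  unfold IsTwoCycle
  rw [hn2]
  refine ⟨hm, ⟨⟨(τ.trans (straighten y)).trans
    ((Equiv.prodComm _ _).trans (Equiv.boolProdEquivSum _)), ?_⟩⟩⟩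
  intro u v
  rw [inputGraph_strandInput_adj y (by omega), strandStep_iff, strandStep_iff, heven]
  simp only [Equiv.trans_apply]
  have hp : (τ u).1 = (straighten y (τ u)).1 := rfl
  have hq : (τ v).1 = (straighten y (τ v)).1 := rfl
  rw [hp, hq]
  obtain ⟨i, a⟩ := straighten y (τ u)
  obtain ⟨j, b⟩ := straighten y (τ v)
  have hadj := cycleGraph_adj_iff_cyclicStep (by omega : 2 ≤ m) i j
  unfold CyclicStep at hadj
  cases a <;> cases b <;> simp [Equiv.boolProdEquivSum, hadj]

theorem not_isOneCycle_of_isTwoCycle {x : PotentialEdge n → Bool} (h : IsTwoCycle x) :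
    ¬ IsOneCycle x := by
  rintro ⟨-, ⟨f⟩⟩
  obtain ⟨hm, ⟨g⟩⟩ := h
  -- Walks never leave a summand of the disjoint sum, whereas a cycle is connected.
  have hside : ∀ u v : Fin n, (inputGraph x).Reachable u v →
      ((g u).isLeft = (g v).isLeft) := by
    rintro u v ⟨w⟩
    induction w with
    | nil => rfl
    | cons h _ ih =>
      rw [← ih]
      have h := g.map_rel_iff'.2 h
      revert h
      simp only [RelIso.coe_fn_toEquiv]
      generalize g _ = p
      generalize g _ = q
      cases p <;> cases q <;> simp
  have hconn : (inputGraph x).Preconnected := fun u v => by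
    have := (SimpleGraph.cycleGraph_preconnected (f u) (f v)).map f.symm.toHom
    simpa using this
  have := hside _ _ (hconn (g.symm (Sum.inl ⟨0, by omega⟩)) (g.symm (Sum.inr ⟨0, by omega⟩)))
  simp at this

end TwoStrands

/-! ### The round lower bounds. -/

/-- An algorithm for the 1-versus-2-cycle problem on `2 * m` vertices computes the parity of `m`
bits, so that its degree, at most `S ^ (2 * R)`, is at least `m`. -/
theorem half_le_pow_of_computes {κ ν M : Type*} [Fintype M] {n m R : ℕ} {S : ℝ} (hm : 3 ≤ m)
    (hn : n = 2 * m) (hS : 1 < S) (A : AMPCAlgorithm (PotentialEdge n) κ ν M)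
    (hA : A.Computes S R (oneVsTwoCycle n)) : (m : ℝ) ≤ S ^ (2 * R) := by
  classical
  have hS0 : 0 ≤ S := by linarith
  let τ : Fin n ≃ Fin m × Bool := Fintype.equivOfCardEq (by simp [hn, mul_comm])
  have hdom : ∀ y : Fin m → Bool, strandInput y τ ∈ oneVsTwoCycleDomain n := fun y => by
    cases h : crossParity y m
    · exact Or.inr (isTwoCycle_strandInput y hm hn τ h)
    · exact Or.inl (isOneCycle_strandInput y hm hn τ h)
  have hval : ∀ y : Fin m → Bool, oneVsTwoCycle n ⟨_, hdom y⟩ = crossParity y m := fun y => by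
    cases h : crossParity y m
    · exact decide_eq_false (not_isOneCycle_of_isTwoCycle (isTwoCycle_strandInput y hm hn τ h))
    · exact decide_eq_true (isOneCycle_strandInput y hm hn τ h)
  have hdeg := A.dds_mem_lowDegree hS0 (fun y => strandInput y τ) (strandInput_dependsOn hm τ)
    (fun y r hr k => hA.key_le _ r hr k) R le_rfl AMPCKey.answer
  have hpar := lowDegree.card_le_of_parity
    -- This functional reads off the answer bit as a real number without raising the degree.
    (lowDegree.map (formalLift fun w => if w = {AMPCValue.bit true} then (1 : ℝ) else 0) hdeg)
    (fun y => by
      have hR : A.dds S (strandInput y τ) R =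
          {(AMPCKey.answer, AMPCValue.bit (crossParity y m))} := by
        rw [← hval y]
        exact hA.correct ⟨_, hdom y⟩
      rw [formalLift_formal, prod_sign_eq_crossParity, hR]
      have hlook : DDS.lookup ({(AMPCKey.answer, AMPCValue.bit (crossParity y m))} :
          DDS (AMPCKey (PotentialEdge n) κ) (AMPCValue ν)) AMPCKey.answer =
          {AMPCValue.bit (crossParity y m)} := by
        simp [DDS.lookup, Multiset.filter_singleton]
      rw [hlook]
      cases crossParity y m <;> norm_num)
  rw [Fintype.card_fin] at hpar
  calc (m : ℝ) ≤ (((⌊S⌋₊ * ⌊S⌋₊) ^ R : ℕ) : ℝ) := by exact_mod_cast hpar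
    _ = (⌊S⌋₊ : ℝ) ^ (2 * R) := by push_cast; rw [pow_mul, sq]
    _ ≤ S ^ (2 * R) := pow_le_pow_left₀ (Nat.cast_nonneg _) (Nat.floor_le hS0) _

theorem logb_le_of_computes {κ ν M : Type*} [Fintype M] {n R : ℕ} {S : ℝ} (hn : Even n)
    (hn6 : 6 ≤ n) (hS : 1 < S) (A : AMPCAlgorithm (PotentialEdge n) κ ν M)
    (hA : A.Computes S R (oneVsTwoCycle n)) : Real.logb S n - Real.logb S 2 ≤ 2 * R := by
  obtain ⟨m, hm⟩ := hn
  have h := half_le_pow_of_computes (m := m) (by omega) (by omega) hS A hA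
  have hm0 : (0 : ℝ) < m := by
    have : 0 < m := by omega
    exact_mod_cast this
  have hnm : (n : ℝ) = 2 * m := by rw [hm]; push_cast; ring
  rw [hnm, Real.logb_mul two_ne_zero hm0.ne', add_sub_cancel_left]
  calc Real.logb S m ≤ Real.logb S (S ^ (2 * R)) := Real.logb_le_logb_of_le hS hm0 h
    _ = 2 * R := by
      rw [Real.logb_pow, Real.logb_self_eq_one hS]
      push_cast
      ring

/-- For `n ≥ 4` the term `logb S 2` is at most half of `logb S n`. -/
theorem quarter_logb_le_of_computes {κ ν M : Type*} [Fintype M] {n R : ℕ} {S : ℝ} (hn : Even n)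
    (hn6 : 6 ≤ n) (hS : 1 < S) (A : AMPCAlgorithm (PotentialEdge n) κ ν M)
    (hA : A.Computes S R (oneVsTwoCycle n)) : 1 / 4 * Real.logb S n ≤ R := by
  have h := logb_le_of_computes hn hn6 hS A hA
  have hn4 : (4 : ℝ) ≤ n := by
    have : 4 ≤ n := by omega
    exact_mod_cast this
  have h4 : Real.logb S 4 = 2 * Real.logb S 2 := by
    rw [show (4 : ℝ) = 2 ^ 2 by norm_num, Real.logb_pow]
    norm_num
  have := Real.logb_le_logb_of_le hS (by norm_num) hn4
  linarith

theorem mainTheorem2 :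
    (∀ (κ : Type*) (ν : Type*) (M : Type*) [Fintype M] (n R : ℕ) (S : ℝ),
      Even n → 1 < S →
      ∀ A : AMPCAlgorithm (PotentialEdge n) κ ν M, A.Computes S R (oneVsTwoCycle n) →
        1 / 3 * Real.logb S n - 1 / 3 * Real.logb S 32 ≤ (R : ℝ)) ∧
    (∃ c : ℝ, 0 < c ∧ ∃ n₀ : ℕ,
      ∀ (κ : Type*) (ν : Type*) (M : Type*) [Fintype M] (n R : ℕ) (S : ℝ),
      Even n → n₀ ≤ n → 1 < S →
      ∀ A : AMPCAlgorithm (PotentialEdge n) κ ν M, A.Computes S R (oneVsTwoCycle n) →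
        c * Real.logb S n ≤ (R : ℝ)) ∧
    (∃ c : ℝ, 0 < c ∧ ∃ n₀ : ℕ,
      ∀ (κ : Type*) (ν : Type*) (M : Type*) [Fintype M] (n R : ℕ) (ε : ℝ),
      Even n → n₀ ≤ n → 0 < ε → ε < 1 →
      ∀ A : AMPCAlgorithm (PotentialEdge n) κ ν M,
        A.Computes ((n : ℝ) ^ ε) R (oneVsTwoCycle n) →
        c / ε ≤ (R : ℝ)) := by

  refine ⟨?_, ⟨1 / 4, by norm_num, 6, ?_⟩, ⟨1 / 4, by norm_num, 6, ?_⟩⟩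
  · intro κ ν M _ n R S hn hS A hA
    have hR : (0 : ℝ) ≤ R := Nat.cast_nonneg R
    -- Here the claimed bound is nonpositive. This covers the sizes below `6`, and `n = 0`, where
    -- `Real.logb S 0 = 0`.
    by_cases h32 : n ≤ 32
    · have hlog : Real.logb S n ≤ Real.logb S 32 := by
        rcases Nat.eq_zero_or_pos n with rfl | hpos
        · simpa using Real.logb_nonneg hS (by norm_num : (1 : ℝ) ≤ 32)
        · exact Real.logb_le_logb_of_le hS (by exact_mod_cast hpos) (by exact_mod_cast h32)
      linarith
    · have h := logb_le_of_computes hn (by omega) hS A hA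
      have := Real.logb_le_logb_of_le hS (by norm_num) (by norm_num : (2 : ℝ) ≤ 32)
      linarith
  · intro κ ν M _ n R S hn hn6 hS A hA
    exact quarter_logb_le_of_computes hn hn6 hS A hA
  · intro κ ν M _ n R ε hn hn6 hε _ A hA
    have hn1 : (1 : ℝ) < n := by
      have : 1 < n := by omega
      exact_mod_cast this
    have hS : 1 < (n : ℝ) ^ ε := Real.one_lt_rpow hn1 hε
    have h := quarter_logb_le_of_computes hn hn6 hS A hA
    have hlog : Real.logb ((n : ℝ) ^ ε) n = 1 / ε := by
      have := Real.log_pos hn1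
      rw [Real.logb, Real.log_rpow (by linarith)]
      field_simp
    rw [hlog] at h
    calc 1 / 4 / ε = 1 / 4 * (1 / ε) := by ring
      _ ≤ R := h
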